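/- Let $A$ be a unital $C^*$-algebra and let $S\subseteq A$ be an operator system generating $A$, i.e. a self-adjoint linear subspace containing $\mathbf 1$ such that $A=C^*(S)$ is the smallest closed $*$-subalgebra of $A$ containing $S$. Let $H$ be a Hilbert space and let $\phi:S\to\mathcal B(H)$ be a unital completely positive (UCP) map. Then the following are equivalent. (1) $\phi$ has the unique extension property: $\phi$ has a unique completely positive extension $\tilde\phi:C^*(S)\to\mathcal B(H)$, and $\tilde\phi$ is a representation (a unital $*$-homomorphism). (2) $\phi$ is maximal: for every Hilbert space $K\supseteq H$ and every UCP map $\phi':S\to\mathcal B(K)$ that dilates $\phi$, i.e. $P_H\phi'(x)\restriction_H=\phi(x)$ for all $x\in S$, there is a UCP map $\psi:S\to\mathcal B(K\ominus H)$ such that $\phi'=\phi\oplus\psi$ with respect to the decomposition $K=H\oplus(K\ominus H)$. -/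

import Mathlib

open scoped CStarAlgebra

universe u v w

/-- An operator system generating the unital C⋆-algebra `A`: a self-adjoint linear subspace `S`
of `A` (not necessarily closed) that contains the unit, such that the smallest closed
star-subalgebra of `A` containing `S` is `A` itself; thus `A` is `C⋆(S)`. -/
structure OperatorSystem (A : Type*) [CStarAlgebra A] extends Submodule ℂ A where
  star_mem : ∀ x ∈ toSubmodule, star x ∈ toSubmodule
  one_mem : (1 : A) ∈ toSubmodule
  generates : (StarAlgebra.adjoin ℂ (toSubmodule : Set A)).topologicalClosure = ⊤

/-- Unital completely positive maps `S → B(H)` on an operator system. A matrix over `S` is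
positive if it is positive in the C⋆-algebra of matrices over the ambient C⋆-algebra `A`. -/
structure UCPMap {A : Type*} [CStarAlgebra A] [PartialOrder A] [StarOrderedRing A]
    (S : OperatorSystem A) (H : Type*) [NormedAddCommGroup H] [InnerProductSpace ℂ H]
    [CompleteSpace H] extends S.toSubmodule →ₗ[ℂ] (H →L[ℂ] H) where
  map_matrix_nonneg : ∀ (k : ℕ) (M : Matrix (Fin k) (Fin k) S.toSubmodule),
    0 ≤ CStarMatrix.ofMatrix (M.map (fun x => (x : A))) →
      0 ≤ CStarMatrix.ofMatrix (M.map (fun x => toLinearMap x))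
  map_one : toLinearMap ⟨1, S.one_mem⟩ = 1

namespace UCPMap

noncomputable instance {A : Type*} [CStarAlgebra A] [PartialOrder A] [StarOrderedRing A]
    {S : OperatorSystem A} {H : Type*} [NormedAddCommGroup H] [InnerProductSpace ℂ H]
    [CompleteSpace H] : CoeFun (UCPMap S H) (fun _ => S.toSubmodule → (H →L[ℂ] H)) where
  coe φ := φ.toLinearMap

/-- `Φ : A → B(H)` extends `φ : S → B(H)`. -/
def IsExtension {A : Type*} [CStarAlgebra A] [PartialOrder A] [StarOrderedRing A]
    {S : OperatorSystem A} {H : Type*} [NormedAddCommGroup H] [InnerProductSpace ℂ H]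
    [CompleteSpace H] (φ : UCPMap S H) (Φ : A →CP (H →L[ℂ] H)) : Prop :=
  ∀ x : S.toSubmodule, Φ (x : A) = φ x

/-- The unique extension property: `φ` has exactly one completely positive extension to
`A = C⋆(S)`, and this extension is a representation (a unital star-homomorphism into `B(H)`). -/
def HasUniqueExtensionProperty {A : Type*} [CStarAlgebra A] [PartialOrder A] [StarOrderedRing A]
    {S : OperatorSystem A} {H : Type*} [NormedAddCommGroup H] [InnerProductSpace ℂ H]
    [CompleteSpace H] (φ : UCPMap S H) : Prop :=
  ∃ Φ : A →CP (H →L[ℂ] H), φ.IsExtension Φ ∧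
    (∀ Ψ : A →CP (H →L[ℂ] H), φ.IsExtension Ψ → Ψ = Φ) ∧
    ∃ π : A →⋆ₐ[ℂ] (H →L[ℂ] H), ∀ a : A, π a = Φ a

/-- `φ'` on `K` is a dilation of `φ` on `H`, where `H` is regarded as a subspace of `K` through
the linear isometry `V`: the compression `V⋆ φ'(x) V` is `φ(x)` for all `x` in `S`. -/
def IsDilation {A : Type*} [CStarAlgebra A] [PartialOrder A] [StarOrderedRing A]
    {S : OperatorSystem A} {H : Type*} [NormedAddCommGroup H] [InnerProductSpace ℂ H]
    [CompleteSpace H] {K : Type*} [NormedAddCommGroup K] [InnerProductSpace ℂ K]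
    [CompleteSpace K] (φ : UCPMap S H) (V : H →ₗᵢ[ℂ] K) (φ' : UCPMap S K) : Prop :=
  ∀ x : S.toSubmodule,
    ContinuousLinearMap.adjoint V.toContinuousLinearMap ∘L φ' x ∘L V.toContinuousLinearMap = φ x

/-- With respect to the decomposition `K = V(H) ⊕ V(H)ᗮ`, the map `φ'` is the direct sum of
`φ` and `ψ`. -/
def IsDirectSum {A : Type*} [CStarAlgebra A] [PartialOrder A] [StarOrderedRing A]
    {S : OperatorSystem A} {H : Type*} [NormedAddCommGroup H] [InnerProductSpace ℂ H]
    [CompleteSpace H] {K : Type*} [NormedAddCommGroup K] [InnerProductSpace ℂ K]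
    [CompleteSpace K] (V : H →ₗᵢ[ℂ] K) (φ' : UCPMap S K) (φ : UCPMap S H)
    (ψ : UCPMap S ((LinearMap.range V.toLinearMap)ᗮ : Submodule ℂ K)) : Prop :=
  ∀ (x : S.toSubmodule) (h : H) (k : ((LinearMap.range V.toLinearMap)ᗮ : Submodule ℂ K)),
    φ' x (V h + (k : K)) = V (φ x h) + (ψ x k : K)

/-- `φ` is maximal: every dilation `φ'` of `φ` (on a Hilbert space in the universe `w`) is
trivial, that is, `φ' = φ ⊕ ψ` for some UCP map `ψ`. -/
def IsMaximal {A : Type u} [CStarAlgebra A] [PartialOrder A] [StarOrderedRing A]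
    {S : OperatorSystem A} {H : Type v} [NormedAddCommGroup H] [InnerProductSpace ℂ H]
    [CompleteSpace H] (φ : UCPMap S H) : Prop :=
  ∀ (K : Type w) [NormedAddCommGroup K] [InnerProductSpace ℂ K] [CompleteSpace K]
    (V : H →ₗᵢ[ℂ] K) (φ' : UCPMap S K), φ.IsDilation V φ' →
      ∃ ψ : UCPMap S ((LinearMap.range V.toLinearMap)ᗮ : Submodule ℂ K), IsDirectSum V φ' φ ψ

end UCPMap

/-! Everything rests on `UCPMap.exists_representation_dilation`: each UCP map on `S` is the
compression of a representation of all of `A`. Pairing matrix entries with vectors of `H` turns the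
map into one functional on finitely supported matrices over `S`; complete positivity is positivity
of this functional. Riesz extension carries it to matrices over `A`, and a GNS construction on `H →₀
A` gives the representation. Maximal implies unique extension: dilate a completely positive
extension `Ψ` to a representation `π`. Then `π` restricted to `S` dilates `φ`, so maximality makes
`H` invariant under `π(S)`, hence reducing for `π` since `S` generates `A`. So `Ψ` is a
representation, determined by its values on `S`. Conversely, let `φ'` dilate `φ` and be compressed
from `π`. Compressing `π` to `H` extends `φ`, so it is the unique extension and is multiplicative;
this forces `H` to be invariant under `π`, hence under `φ'`. As `φ'` respects adjoints, the
complement is invariant too. -/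

open scoped ComplexOrder InnerProductSpace

/-! ### Positivity of matrices over a C⋆-algebra -/

namespace NonUnitalCStarAlgebra

variable {B : Type*} [NonUnitalCStarAlgebra B] [PartialOrder B] [StarOrderedRing B]

lemma exists_eq_star_mul_self {b : B} (hb : 0 ≤ b) : ∃ c, b = star c * c :=
  CStarAlgebra.nonneg_iff_eq_star_mul_self.1 hb

lemma exists_eq_sub_of_isSelfAdjoint {b : B} (hb : IsSelfAdjoint b) :
    ∃ p q : B, 0 ≤ p ∧ 0 ≤ q ∧ b = p - q ∧ q * p = 0 :=
  ⟨b⁺, b⁻, CFC.posPart_nonneg b, CFC.negPart_nonneg b, (CFC.posPart_sub_negPart b hb).symm,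
    CFC.negPart_mul_posPart b⟩

end NonUnitalCStarAlgebra

namespace CStarMatrix

open NonUnitalCStarAlgebra

variable {A : Type*} [CStarAlgebra A] [PartialOrder A] [StarOrderedRing A]
  {n : Type*} [Fintype n]

lemma eq_zero_of_star_mul_self_apply_nonpos {T : CStarMatrix n n A}
    (h : ∀ i, (star T * T) i i ≤ 0) : T = 0 := by
  ext k i
  have hi : ∑ j, star (T j i) * T j i = 0 := by
    refine le_antisymm ?_ (Finset.sum_nonneg fun j _ => star_mul_self_nonneg _)
    simpa [mul_apply, star_apply] using h i
  have := (Finset.sum_eq_zero_iff_of_nonneg fun j _ => star_mul_self_nonneg (T j i)).1 hi k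
    (Finset.mem_univ k)
  simpa [CStarRing.star_mul_self_eq_zero_iff] using this

/-- A self-adjoint matrix over a C⋆-algebra is positive if all its values as a quadratic form on
column vectors are positive. -/
theorem nonneg_of_forall_sum_nonneg {M : CStarMatrix n n A} (hM : IsSelfAdjoint M)
    (h : ∀ a : n → A, 0 ≤ ∑ i, ∑ j, star (a i) * M i j * a j) : 0 ≤ M := by
  obtain ⟨P, Q, hP, hQ, rfl, hQP⟩ := exists_eq_sub_of_isSelfAdjoint hM
  -- Conjugating by `Q` removes `P`. The diagonal entries of the result are values of the form at
  -- the columns of `Q`, hence positive, while those of `Q * Q * Q` are positive as well; this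
  -- forces `Q = 0`.
  have hcube : Q * (P - Q) * Q = -(Q * Q * Q) := by
    rw [mul_sub, hQP, zero_sub, neg_mul]
  obtain ⟨R, hR⟩ := exists_eq_star_mul_self hQ
  have hT : Q * Q * Q = star (R * Q) * (R * Q) := by
    rw [star_mul, hQ.isSelfAdjoint.star_eq]
    nth_rewrite 2 [hR]
    simp only [mul_assoc]
  have hRQ : R * Q = 0 := by
    refine eq_zero_of_star_mul_self_apply_nonpos fun i => ?_
    rw [← hT, ← neg_nonneg]
    have h1 : 0 ≤ (Q * (P - Q) * Q) i i := by
      convert h (fun j => Q j i) using 1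
      have hs : ∀ j, star (Q j i) = Q i j := fun j =>
        star_apply_of_isSelfAdjoint hQ.isSelfAdjoint
      rw [mul_apply]
      simp only [mul_apply, hs, Finset.sum_mul]
      exact Finset.sum_comm
    rw [hcube] at h1
    exact h1
  have hsq : star Q * Q = 0 := by
    rw [hQ.isSelfAdjoint.star_eq]
    nth_rewrite 1 [hR]
    rw [mul_assoc, hRQ, mul_zero]
  rw [(CStarRing.star_mul_self_eq_zero_iff _).1 hsq, sub_zero]
  exact hP

variable {H : Type*} [NormedAddCommGroup H] [InnerProductSpace ℂ H] [CompleteSpace H]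
  {K : Type*} [NormedAddCommGroup K] [InnerProductSpace ℂ K] [CompleteSpace K]

lemma sum_inner_nonneg {M : CStarMatrix n n (H →L[ℂ] H)} (hM : 0 ≤ M) (h : n → H) :
    0 ≤ ∑ i, ∑ j, ⟪h i, M i j (h j)⟫_ℂ := by
  obtain ⟨N, rfl⟩ := exists_eq_star_mul_self hM
  have : ∑ i, ∑ j, ⟪h i, (star N * N) i j (h j)⟫_ℂ
      = ∑ k, ⟪∑ i, N k i (h i), ∑ j, N k j (h j)⟫_ℂ := by
    simp only [mul_apply, star_apply, sum_inner, inner_sum, sum_apply,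
      ContinuousLinearMap.mul_def, ContinuousLinearMap.comp_apply,
      ContinuousLinearMap.star_eq_adjoint, ContinuousLinearMap.adjoint_inner_right]
    rw [Finset.sum_comm_cycle]
    exact Finset.sum_congr rfl fun k _ => Finset.sum_comm
  rw [this]
  refine Finset.sum_nonneg fun k _ => ?_
  rw [inner_self_eq_norm_sq_to_K]
  positivity

/-- Compressing the entries of a positive operator matrix gives a positive operator matrix. -/
theorem compression_nonneg {M : CStarMatrix n n (K →L[ℂ] K)} (hM : 0 ≤ M) (V : H →L[ℂ] K) :
    0 ≤ M.map fun T => ContinuousLinearMap.adjoint V ∘L T ∘L V := by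
  refine nonneg_of_forall_sum_nonneg ?_ fun a => ?_
  · ext i j : 1
    have : star (M j i) = M i j := star_apply_of_isSelfAdjoint hM.isSelfAdjoint
    simp only [star_apply, map_apply, ← this, ContinuousLinearMap.star_eq_adjoint,
      ContinuousLinearMap.adjoint_comp, ContinuousLinearMap.adjoint_adjoint,
      ContinuousLinearMap.comp_assoc]
  · rw [ContinuousLinearMap.nonneg_iff_isPositive, ContinuousLinearMap.isPositive_iff_complex]
    intro x
    have h := sum_inner_nonneg hM fun i => V (a i x)
    set T := ∑ i, ∑ j, star (a i) *
      (M.map fun T => ContinuousLinearMap.adjoint V ∘L T ∘L V) i j * a j with hT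
    have hx : ⟪x, T x⟫_ℂ = ∑ i, ∑ j, ⟪V (a i x), M i j (V (a j x))⟫_ℂ := by
      simp [hT, ContinuousLinearMap.star_eq_adjoint, ContinuousLinearMap.adjoint_inner_right]
    rw [← hx] at h
    have hre := RCLike.nonneg_iff.1 h
    have hconj := RCLike.conj_eq_iff_im.2 hre.2
    rw [← inner_conj_symm, hconj]
    exact ⟨RCLike.conj_eq_iff_re.1 hconj, hre.1⟩

end CStarMatrix

open ContinuousLinearMap (adjoint)

lemma LinearIsometry.adjoint_comp_toContinuousLinearMap
    {H : Type*} [NormedAddCommGroup H] [InnerProductSpace ℂ H] [CompleteSpace H]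
    {K : Type*} [NormedAddCommGroup K] [InnerProductSpace ℂ K] [CompleteSpace K]
    (V : H →ₗᵢ[ℂ] K) :
    adjoint V.toContinuousLinearMap ∘L V.toContinuousLinearMap = 1 := by
  ext h
  exact ext_inner_left ℂ fun k => by simp

section CStarAlgebra

variable {A : Type*} [CStarAlgebra A] [PartialOrder A] [StarOrderedRing A]

/-- Expand the square of `a + x * b` and bound its last term by the norm. This is positivity of the
2×2 matrix with rows `(1, x)` and `(star x, ‖star x * x‖)`. -/
lemma CStarAlgebra.zero_le_star_mul_self_add_add_norm_smul (x a b : A) :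
    0 ≤ star a * a + star a * x * b + star b * star x * a + ‖star x * x‖ • (star b * b) := by
  have h1 : star b * (star x * x) * b ≤ ‖star x * x‖ • (star b * b) :=
    CStarAlgebra.star_left_conjugate_le_norm_smul
  have h2 : 0 ≤ star (a + x * b) * (a + x * b) := star_mul_self_nonneg _
  calc 0 ≤ star (a + x * b) * (a + x * b) := h2
    _ = star a * a + star a * x * b + star b * star x * a + star b * (star x * x) * b := by
      simp only [star_add, star_mul]; noncomm_ring
    _ ≤ _ := by gcongr

end CStarAlgebra

/-! ### Basic properties of completely positive maps -/

namespace UCPMap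

variable {A : Type u} [CStarAlgebra A] [PartialOrder A] [StarOrderedRing A]
  {S : OperatorSystem A}
  {H : Type*} [NormedAddCommGroup H] [InnerProductSpace ℂ H] [CompleteSpace H]
  {K : Type*} [NormedAddCommGroup K] [InnerProductSpace ℂ K] [CompleteSpace K]

/-- Complete positivity at size 2 suffices: `x` and `star x` are the off-diagonal entries of a
positive matrix over `S`, and its image is positive, hence self-adjoint. -/
lemma map_star (φ : UCPMap S H) (x : S.toSubmodule) :
    φ ⟨star (x : A), S.star_mem x x.2⟩ = star (φ x) := by
  let one : S.toSubmodule := ⟨1, S.one_mem⟩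
  let M : Matrix (Fin 2) (Fin 2) S.toSubmodule :=
    !![one, x; ⟨star (x : A), S.star_mem x x.2⟩, (‖star (x : A) * x‖ : ℂ) • one]
  have hM : 0 ≤ CStarMatrix.ofMatrix (M.map (fun x => (x : A))) := by
    refine CStarMatrix.nonneg_of_forall_sum_nonneg ?_ fun a => ?_
    · ext i j
      rw [CStarMatrix.star_apply]
      fin_cases i <;> fin_cases j <;> simp [M, one]
    · convert CStarAlgebra.zero_le_star_mul_self_add_add_norm_smul (x : A) (a 0) (a 1) using 1
      simp [M, one, Fin.sum_univ_two, add_assoc]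
  have h := (φ.map_matrix_nonneg 2 M hM).isSelfAdjoint
  exact (CStarMatrix.star_apply_of_isSelfAdjoint h (i := 0) (j := 1)).symm

/-- The compression of a unital completely positive map by an isometry. -/
noncomputable def compression (φ : UCPMap S K) (V : H →ₗᵢ[ℂ] K) : UCPMap S H where
  toFun x := adjoint V.toContinuousLinearMap ∘L φ x ∘L V.toContinuousLinearMap
  map_add' x y := by simp
  map_smul' c x := by simp
  map_matrix_nonneg k M hM :=
    CStarMatrix.compression_nonneg (φ.map_matrix_nonneg k M hM) V.toContinuousLinearMap
  map_one := by
    have h1 : φ.toLinearMap ⟨1, S.one_mem⟩ = 1 := φ.map_one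
    change adjoint V.toContinuousLinearMap ∘L φ ⟨1, S.one_mem⟩ ∘L V.toContinuousLinearMap = 1
    rw [h1]
    exact V.adjoint_comp_toContinuousLinearMap

/-- The restriction of a unital completely positive map on `A` to an operator system. -/
noncomputable def ofCompletelyPositiveMap (Φ : A →CP (H →L[ℂ] H)) (h1 : Φ 1 = 1) :
    UCPMap S H where
  toLinearMap := Φ.toLinearMap ∘ₗ S.toSubmodule.subtype
  map_matrix_nonneg k _ hM := Φ.map_cstarMatrix_nonneg' k _ hM
  map_one := h1

end UCPMap

lemma OperatorSystem.eq_top_of_isClosed {A : Type*} [CStarAlgebra A]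
    (S : OperatorSystem A) {T : StarSubalgebra ℂ A}
    (hT : IsClosed (T : Set A)) (hS : ∀ x ∈ S.toSubmodule, x ∈ T) : T = ⊤ := by
  rw [eq_top_iff, ← S.generates]
  exact StarSubalgebra.topologicalClosure_minimal (StarAlgebra.adjoin_le hS) hT

section CompletelyPositive

variable {A : Type u} [CStarAlgebra A] [PartialOrder A] [StarOrderedRing A]
  {H : Type*} [NormedAddCommGroup H] [InnerProductSpace ℂ H] [CompleteSpace H]
  {K : Type*} [NormedAddCommGroup K] [InnerProductSpace ℂ K] [CompleteSpace K]

/-- A representation of `A` as a completely positive map. -/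
noncomputable def StarAlgHom.toCompletelyPositiveMap (π : A →⋆ₐ[ℂ] (K →L[ℂ] K)) :
    A →CP (K →L[ℂ] K) :=
  CompletelyPositiveMapClass.toCompletelyPositiveLinearMap π

/-- The compression of a completely positive map by an operator. -/
noncomputable def CompletelyPositiveMap.compression (Φ : A →CP (K →L[ℂ] K)) (V : H →L[ℂ] K) :
    A →CP (H →L[ℂ] H) where
  toFun a := adjoint V ∘L Φ a ∘L V
  map_add' x y := by simp
  map_smul' c x := by simp
  map_cstarMatrix_nonneg' k M hM :=
    CStarMatrix.compression_nonneg (Φ.map_cstarMatrix_nonneg' k M hM) V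

end CompletelyPositive

/-! ### Representations and reducing subspaces -/

section Representation

variable {A : Type u} [CStarAlgebra A]
  {H : Type*} [NormedAddCommGroup H] [InnerProductSpace ℂ H] [CompleteSpace H]
  {K : Type*} [NormedAddCommGroup K] [InnerProductSpace ℂ K] [CompleteSpace K]

lemma OperatorSystem.starAlgHom_ext (S : OperatorSystem A) {π ρ : A →⋆ₐ[ℂ] (H →L[ℂ] H)}
    (h : ∀ x ∈ S.toSubmodule, π x = ρ x) (a : A) : π a = ρ a := by
  have := S.eq_top_of_isClosed (T := StarAlgHom.equalizer π ρ)
    (isClosed_eq (map_continuous π) (map_continuous ρ)) h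
  exact this.ge (StarSubalgebra.mem_top (x := a))

/-- If the range of the isometry `V` is invariant under `π(S)`, then it reduces `π`. -/
lemma OperatorSystem.commute_of_map_comp_eq (S : OperatorSystem A) (π : A →⋆ₐ[ℂ] (K →L[ℂ] K))
    (V : H →ₗᵢ[ℂ] K)
    (h : ∀ x ∈ S.toSubmodule, ∃ T : H →L[ℂ] H,
      π x ∘L V.toContinuousLinearMap = V.toContinuousLinearMap ∘L T) (a : A) :
    Commute (V.toContinuousLinearMap ∘L adjoint V.toContinuousLinearMap) (π a) := by
  set P : K →L[ℂ] K := V.toContinuousLinearMap ∘L adjoint V.toContinuousLinearMap with hP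
  have hVV := V.adjoint_comp_toContinuousLinearMap
  have hPs : star P = P := by
    rw [hP, ContinuousLinearMap.star_eq_adjoint, ContinuousLinearMap.adjoint_comp,
      ContinuousLinearMap.adjoint_adjoint]
  have hinv : ∀ x ∈ S.toSubmodule, P * π x * P = π x * P := by
    intro x hx
    obtain ⟨T, hT⟩ := h x hx
    have : π x * P = V.toContinuousLinearMap ∘L T ∘L adjoint V.toContinuousLinearMap := by
      rw [hP, ContinuousLinearMap.mul_def, ← ContinuousLinearMap.comp_assoc, hT,
        ContinuousLinearMap.comp_assoc]
    rw [mul_assoc, this, hP, ContinuousLinearMap.mul_def, ContinuousLinearMap.comp_assoc,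
      ← ContinuousLinearMap.comp_assoc (adjoint V.toContinuousLinearMap), hVV]
    rfl
  have htop := S.eq_top_of_isClosed
    (T := (StarSubalgebra.centralizer ℂ {P}).comap π) ?_ ?_
  · have := htop.ge (StarSubalgebra.mem_top (x := a))
    rw [StarSubalgebra.mem_comap, StarSubalgebra.mem_centralizer_iff] at this
    exact (this P rfl).1
  · have : ((StarSubalgebra.comap π (StarSubalgebra.centralizer ℂ {P}) : StarSubalgebra ℂ A) :
        Set A) = {a | P * π a = π a * P} := by
      ext a
      change π a ∈ StarSubalgebra.centralizer ℂ {P} ↔ _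
      rw [StarSubalgebra.mem_centralizer_iff]
      simp [hPs]
    rw [this]
    exact isClosed_eq (continuous_const.mul (map_continuous π))
      ((map_continuous π).mul continuous_const)
  · intro x hx
    have h1 := hinv x hx
    -- Invariance under `star x`, after taking adjoints, gives `P * π x * P = P * π x`.
    have h2 := congrArg star (hinv _ (S.star_mem x hx))
    simp only [star_mul, hPs, StarHomClass.map_star, star_star, ← mul_assoc] at h2
    rw [StarSubalgebra.mem_comap, StarSubalgebra.mem_centralizer_iff]
    rintro g rfl
    rw [hPs, and_self]
    exact h2.symm.trans h1

/-- The compression of a representation to a reducing subspace is a representation. -/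
lemma StarAlgHom.exists_compression_eq (π : A →⋆ₐ[ℂ] (K →L[ℂ] K)) (V : H →ₗᵢ[ℂ] K)
    (h : ∀ a, Commute (V.toContinuousLinearMap ∘L adjoint V.toContinuousLinearMap) (π a)) :
    ∃ ρ : A →⋆ₐ[ℂ] (H →L[ℂ] H), ∀ a,
      ρ a = adjoint V.toContinuousLinearMap ∘L π a ∘L V.toContinuousLinearMap := by
  set W := V.toContinuousLinearMap
  have hVV : adjoint W ∘L W = 1 := V.adjoint_comp_toContinuousLinearMap
  have hW : ∀ a, π a ∘L W = W ∘L adjoint W ∘L π a ∘L W := fun a => by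
    calc π a ∘L W = (π a * (W ∘L adjoint W)) ∘L W := by
          rw [ContinuousLinearMap.mul_def, ContinuousLinearMap.comp_assoc,
            ContinuousLinearMap.comp_assoc, hVV]
          rfl
      _ = _ := by rw [← (h a).eq]; rfl
  have hone : adjoint W ∘L (π 1) ∘L W = 1 := by
    rw [map_one]
    exact hVV
  refine ⟨{
    toFun := fun a => adjoint W ∘L π a ∘L W
    map_one' := hone
    map_mul' := fun a b => ?_
    map_zero' := by simp
    map_add' := by simp
    commutes' := fun r => ?_
    map_star' := fun a => ?_ }, fun a => rfl⟩
  · rw [map_mul, ContinuousLinearMap.mul_def, ContinuousLinearMap.mul_def,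
      ContinuousLinearMap.comp_assoc]
    conv_lhs => rw [hW b]
    simp only [ContinuousLinearMap.comp_assoc]
  · rw [Algebra.algebraMap_eq_smul_one, map_smul, Algebra.algebraMap_eq_smul_one, ← hone]
    simp
  · simp [StarHomClass.map_star, ContinuousLinearMap.star_eq_adjoint, ContinuousLinearMap.adjoint_comp,
      ContinuousLinearMap.comp_assoc]

end Representation

/-! ### GNS completion -/

section PreInner

open UniformSpace UniformSpace.Completion

/-- A bounded action of a C⋆-algebra by adjointable operators on a space with a semi-inner product
passes to a representation on the associated Hilbert space. -/
theorem PreInnerProductSpace.Core.exists_starAlgHom {A : Type u} [CStarAlgebra A]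
    {X : Type v} [AddCommGroup X] [Module ℂ X] (c : PreInnerProductSpace.Core ℂ X)
    (m : A →ₐ[ℂ] Module.End ℂ X)
    (hbound : ∀ a x, (c.inner (m a x) (m a x)).re ≤ ‖a‖ ^ 2 * (c.inner x x).re)
    (hadj : ∀ a x y, c.inner (m (star a) x) y = c.inner x (m a y)) :
    ∃ (K : Type v) (_ : NormedAddCommGroup K) (_ : InnerProductSpace ℂ K) (_ : CompleteSpace K)
      (π : A →⋆ₐ[ℂ] (K →L[ℂ] K)) (J : X →ₗ[ℂ] K),
      (∀ x y, ⟪J x, J y⟫_ℂ = c.inner x y) ∧ ∀ a x, π a (J x) = J (m a x) := by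
  let _ : SeminormedAddCommGroup X := InnerProductSpace.Core.toSeminormedAddCommGroup (c := c)
  let _ : InnerProductSpace ℂ X := InnerProductSpace.ofCore c
  have hinner : ∀ x y : X, ⟪x, y⟫_ℂ = c.inner x y := fun _ _ => rfl
  let L : A → X →L[ℂ] X := fun a => (m a).mkContinuous ‖a‖ fun x => by
    rw [← sq_le_sq₀ (by positivity) (by positivity), mul_pow,
      ← inner_self_eq_norm_sq (𝕜 := ℂ) x,
      ← inner_self_eq_norm_sq (𝕜 := ℂ) (m a x)]
    exact hbound a x
  have hL : ∀ a x, L a x = m a x := fun _ _ => rfl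
  refine ⟨Completion X, inferInstance, inferInstance, inferInstance, {
    toFun := fun a => (L a).completion
    map_one' := ?_
    map_mul' := fun a b => ?_
    map_zero' := ?_
    map_add' := fun a b => ?_
    commutes' := fun r => ?_
    map_star' := fun a => ?_ }, (toComplL : X →L[ℂ] Completion X).toLinearMap, fun x y => ?_,
      fun a x => ?_⟩
  · ext x
    induction x using induction_on with
    | hp => apply isClosed_eq <;> fun_prop
    | ih x => simp [hL]
  · ext x
    induction x using induction_on with
    | hp => apply isClosed_eq <;> fun_prop
    | ih x => simp [hL]
  · ext x
    induction x using induction_on with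
    | hp => apply isClosed_eq <;> fun_prop
    | ih x => simp [hL, Completion.coe_zero]
  · ext x
    induction x using induction_on with
    | hp => apply isClosed_eq <;> fun_prop
    | ih x => simp [hL, Completion.coe_add]
  · ext x
    induction x using induction_on with
    | hp => apply isClosed_eq <;> fun_prop
    | ih x => simp [hL, Algebra.algebraMap_eq_smul_one]
  · rw [ContinuousLinearMap.star_eq_adjoint, ContinuousLinearMap.eq_adjoint_iff]
    intro x y
    induction x, y using induction_on₂ with
    | hp => apply isClosed_eq <;> fun_prop
    | ih x y => simp [hL, hinner, hadj]
  · simp [hinner]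
  · simp [hL]

end PreInner

/-! ### Finitely supported matrices as quadratic forms -/

namespace Finsupp

variable {ι : Type*} {A : Type*} [CStarAlgebra A]

/-- Pairing a finitely supported matrix over `A` with a family of elements of `A`, as a
quadratic form: `x ↦ ∑ i j, star (α i) * x (i, j) * α j`. -/
noncomputable def pairing (α : ι → A) : (ι × ι →₀ A) →ₗ[ℂ] A :=
  Finsupp.lsum ℂ fun p => LinearMap.mulLeftRight ℂ (star (α p.1), α p.2)

lemma pairing_apply (α : ι → A) (x : ι × ι →₀ A) :
    pairing α x = x.sum fun p c => star (α p.1) * c * α p.2 := rfl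

@[simp]
lemma pairing_single (α : ι → A) (p : ι × ι) (c : A) :
    pairing α (single p c) = star (α p.1) * c * α p.2 := by
  simp [pairing]

/-- The finitely supported matrix `(i, j) ↦ star (f i) * g j`. -/
noncomputable def starMulMatrix (f g : ι →₀ A) : ι × ι →₀ A :=
  onFinset (f.support ×ˢ g.support) (fun p => star (f p.1) * g p.2) fun p hp => by
    simp only [Finset.mem_product, mem_support_iff]
    exact ⟨fun h => hp (by simp [h]), fun h => hp (by simp [h])⟩

@[simp]
lemma starMulMatrix_apply (f g : ι →₀ A) (p : ι × ι) :
    starMulMatrix f g p = star (f p.1) * g p.2 := rfl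

lemma pairing_starMulMatrix (α : ι → A) (f g : ι →₀ A) :
    pairing α (starMulMatrix f g) =
      star (f.sum fun i a => a * α i) * g.sum fun i a => a * α i := by
  rw [pairing_apply, starMulMatrix, onFinset_sum _ (by simp), Finset.sum_product, Finsupp.sum,
    Finsupp.sum, star_sum, Finset.sum_mul_sum]
  simp [mul_assoc]

lemma starMulMatrix_single (i j : ι) (a b : A) :
    starMulMatrix (single i a) (single j b) = single (i, j) (star a * b) := by
  classical
  ext ⟨k, l⟩
  by_cases hi : i = k <;> by_cases hj : j = l <;> simp [hi, hj]

lemma sum_prod_eq_sum_fin {M N : Type*} [Zero M] [AddCommMonoid N] {x : ι × ι →₀ M}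
    {F : Finset ι} (hF : ∀ p ∈ x.support, p.1 ∈ F ∧ p.2 ∈ F) (g : ι × ι → M → N)
    (hg : ∀ p, g p 0 = 0) :
    x.sum g = ∑ i, ∑ j, g ((F.equivFin.symm i : ι), (F.equivFin.symm j : ι))
      (x ((F.equivFin.symm i : ι), (F.equivFin.symm j : ι))) := by
  rw [x.sum_of_support_subset (s := F ×ˢ F) (fun p hp => Finset.mem_product.2 (hF p hp)) g
    (fun p _ => hg p), Finset.sum_product, ← Finset.sum_coe_sort F, ← F.equivFin.symm.sum_comp]
  refine Finset.sum_congr rfl fun i _ => ?_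
  rw [← Finset.sum_coe_sort F, ← F.equivFin.symm.sum_comp]

end Finsupp

/-! ### Arveson extension and Stinespring dilation -/

namespace UCPMap

open Finsupp

variable {A : Type u} [CStarAlgebra A] [PartialOrder A] [StarOrderedRing A]
  {S : OperatorSystem A} {H : Type v} [NormedAddCommGroup H] [InnerProductSpace ℂ H]
  [CompleteSpace H] {ι : Type*}

/-- The finitely supported matrices over `A` whose real part is positive as a quadratic form. -/
noncomputable def accretiveCone (ι : Type*) (A : Type*) [CStarAlgebra A] [PartialOrder A]
    [StarOrderedRing A] : PointedCone ℝ (ι × ι →₀ A) where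
  carrier := {x | ∀ α : ι → A, 0 ≤ pairing α x + star (pairing α x)}
  zero_mem' α := by simp
  add_mem' {x y} hx hy α := by
    have := add_nonneg (hx α) (hy α)
    rw [map_add, star_add]
    convert this using 1
    abel
  smul_mem' r x hx α := by
    have h := smul_nonneg r.2 (hx α)
    have hr : pairing α (r • x) = (r : ℝ) • pairing α x :=
      (pairing α).map_smul_of_tower (r : ℝ) x
    rwa [smul_add, ← star_trivial (r : ℝ), ← star_smul, star_trivial, ← hr] at h

/-- The cofinality hypothesis of `riesz_extension`. An entry `c` at `(i, j)` is dominated by scalar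
diagonal entries at `(i, i)` and `(j, j)`, which lie in `S`. -/
lemma exists_add_mem_accretiveCone (S : OperatorSystem A) (y : ι × ι →₀ A) :
    ∃ x : ι × ι →₀ A, (∀ p, x p ∈ S.toSubmodule) ∧ x + y ∈ accretiveCone ι A := by
  classical
  induction y using Finsupp.induction_linear with
  | zero => exact ⟨0, fun p => S.zero_mem, by simp⟩
  | add y₁ y₂ h₁ h₂ =>
    obtain ⟨x₁, hx₁, hm₁⟩ := h₁
    obtain ⟨x₂, hx₂, hm₂⟩ := h₂
    refine ⟨x₁ + x₂, fun p => S.add_mem (hx₁ p) (hx₂ p), ?_⟩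
    rw [add_add_add_comm]
    exact add_mem hm₁ hm₂
  | single p c =>
    obtain ⟨i, j⟩ := p
    have hS : ∀ (q : ι × ι) (r : ℂ) p, single q (r • (1 : A)) p ∈ S.toSubmodule := by
      intro q r p
      rw [single_apply]
      split_ifs
      exacts [S.smul_mem _ S.one_mem, S.zero_mem]
    refine ⟨single (i, i) ((1 : ℂ) • 1) + single (j, j) ((‖star c * c‖ : ℂ) • 1),
      fun p => S.add_mem (hS _ _ _) (hS _ _ _), fun α => ?_⟩
    have h1 := CStarAlgebra.zero_le_star_mul_self_add_add_norm_smul c (α i) (α j)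
    have h2 : 0 ≤ star (α i) * α i + ‖star c * c‖ • (star (α j) * α j) :=
      add_nonneg (star_mul_self_nonneg _) (smul_nonneg (norm_nonneg _) (star_mul_self_nonneg _))
    convert add_nonneg h1 h2 using 1
    simp only [map_add, pairing_single, star_add, star_mul, star_star, one_smul, star_smul,
      mul_smul_comm, smul_mul_assoc, mul_one, mul_assoc, Complex.coe_smul, star_trivial]
    abel

/-- Twice the real part is the form of `φ` applied to the positive matrix `x + star x`, where `star`
is the conjugate transpose. -/
lemma re_sum_inner_nonneg (φ : UCPMap S H) (b : ι → H) {φ₀ : A →ₗ[ℂ] (H →L[ℂ] H)}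
    (hφ₀ : ∀ x : S.toSubmodule, φ₀ x = φ x) {x : ι × ι →₀ A} (hxS : ∀ p, x p ∈ S.toSubmodule)
    (hx : x ∈ accretiveCone ι A) :
    0 ≤ (x.sum fun p c => ⟪b p.1, φ₀ c (b p.2)⟫_ℂ).re := by
  classical
  let F : Finset ι := x.support.image Prod.fst ∪ x.support.image Prod.snd
  have hF : ∀ p ∈ x.support, p.1 ∈ F ∧ p.2 ∈ F := fun p hp =>
    ⟨Finset.mem_union_left _ (Finset.mem_image_of_mem _ hp),
      Finset.mem_union_right _ (Finset.mem_image_of_mem _ hp)⟩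
  let e : Fin F.card → ι := fun i => F.equivFin.symm i
  let M : Matrix (Fin F.card) (Fin F.card) S.toSubmodule := fun i j =>
    ⟨x (e i, e j), hxS _⟩ + ⟨star (x (e j, e i)), S.star_mem _ (hxS _)⟩
  have hM : 0 ≤ CStarMatrix.ofMatrix (M.map (fun x => (x : A))) := by
    refine CStarMatrix.nonneg_of_forall_sum_nonneg ?_ fun a => ?_
    · ext i j
      rw [CStarMatrix.star_apply]
      change star (x (e j, e i) + star (x (e i, e j))) = x (e i, e j) + star (x (e j, e i))
      rw [star_add, star_star, add_comm]
    -- The value off `F` does not matter, since `x` is supported in `F × F`.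
    · let α : ι → A := fun i => if h : i ∈ F then a (F.equivFin ⟨i, h⟩) else 0
      have hα : ∀ i, α (e i) = a i := fun i => by simp [α, e]
      have hp : pairing α x = ∑ i, ∑ j, star (a i) * x (e i, e j) * a j := by
        rw [pairing_apply, sum_prod_eq_sum_fin hF _ (by simp)]
        simp only [← hα, e]
      convert hx α using 1
      rw [hp, star_sum]
      simp_rw [star_sum]
      rw [Finset.sum_comm (f := fun i j => star (star (a i) * x (e i, e j) * a j)),
        ← Finset.sum_add_distrib]
      refine Finset.sum_congr rfl fun i _ => ?_
      rw [← Finset.sum_add_distrib]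
      refine Finset.sum_congr rfl fun j _ => ?_
      change star (a i) * (x (e i, e j) + star (x (e j, e i))) * a j = _
      rw [star_mul, star_mul, star_star, mul_add, add_mul, mul_assoc (star (a i)) (star _)]
  have h := CStarMatrix.sum_inner_nonneg (φ.map_matrix_nonneg _ M hM) fun i => b (e i)
  have hentry : ∀ i j, ⟪b (e i), φ (M i j) (b (e j))⟫_ℂ =
      ⟪b (e i), φ₀ (x (e i, e j)) (b (e j))⟫_ℂ +
        starRingEnd ℂ ⟪b (e j), φ₀ (x (e j, e i)) (b (e i))⟫_ℂ := by
    intro i j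
    have h1 := φ.map_star ⟨x (e j, e i), hxS _⟩
    have h2 := hφ₀ ⟨x (e j, e i), hxS _⟩
    have h3 := hφ₀ ⟨x (e i, e j), hxS _⟩
    simp only at h1 h2 h3
    rw [map_add, h1, ← h2, ← h3, _root_.add_apply, inner_add_right,
      ContinuousLinearMap.star_eq_adjoint, ContinuousLinearMap.adjoint_inner_right,
      inner_conj_symm]
  have hsum : (0 : ℂ) ≤ (x.sum fun p c => ⟪b p.1, φ₀ c (b p.2)⟫_ℂ) +
      starRingEnd ℂ (x.sum fun p c => ⟪b p.1, φ₀ c (b p.2)⟫_ℂ) := by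
    convert h using 1
    rw [sum_prod_eq_sum_fin hF _ (by simp), map_sum]
    simp_rw [map_sum]
    rw [Finset.sum_comm (f := fun i j => starRingEnd ℂ _), ← Finset.sum_add_distrib]
    refine Finset.sum_congr rfl fun i _ => ?_
    rw [← Finset.sum_add_distrib]
    exact Finset.sum_congr rfl fun j _ => (hentry i j).symm
  rw [Complex.add_conj] at hsum
  have := (Complex.le_def.1 hsum).1
  simpa using this

/-- The extension step of Arveson's extension theorem: the functional on matrices over `S` induced
by a unital completely positive map extends to a positive functional on matrices over `A`. -/
theorem exists_positive_functional (φ : UCPMap S H) (b : ι → H) :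
    ∃ G : (ι × ι →₀ A) →ₗ[ℂ] ℂ,
      (∀ i j (x : S.toSubmodule), G (single (i, j) (x : A)) = ⟪b i, φ x (b j)⟫_ℂ) ∧
      (∀ x, (∀ α, 0 ≤ pairing α x) → 0 ≤ G x) ∧
      ∀ x y, (∀ α, pairing α y = star (pairing α x)) → G y = starRingEnd ℂ (G x) := by
  classical
  -- An arbitrary linear extension without positivity, used only at entries in `S`.
  obtain ⟨φ₀, hφ₀⟩ := LinearMap.exists_extend φ.toLinearMap
  replace hφ₀ : ∀ x : S.toSubmodule, φ₀ x = φ x := fun x => LinearMap.congr_fun hφ₀ x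
  let f₀ : (ι × ι →₀ A) →ₗ[ℂ] ℂ := Finsupp.lsum ℂ fun p =>
    (innerSL ℂ (b p.1)).toLinearMap ∘ₗ (ContinuousLinearMap.apply ℂ H (b p.2)).toLinearMap ∘ₗ φ₀
  have hf₀ : ∀ x, f₀ x = x.sum fun p c => ⟪b p.1, φ₀ c (b p.2)⟫_ℂ := fun x => rfl
  let D : Submodule ℂ (ι × ι →₀ A) :=
    { carrier := {x | ∀ p, x p ∈ S.toSubmodule}
      zero_mem' := fun p => S.zero_mem
      add_mem' := fun hx hy p => S.add_mem (hx p) (hy p)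
      smul_mem' := fun c x hx p => S.smul_mem c (hx p) }
  let f : (ι × ι →₀ A) →ₗ.[ℝ] ℝ :=
    ⟨D.restrictScalars ℝ, Complex.reLm ∘ₗ (f₀.restrictScalars ℝ) ∘ₗ
      (D.restrictScalars ℝ).subtype⟩
  obtain ⟨g, hgf, hg⟩ := riesz_extension (accretiveCone ι A) f
    (fun x hx => φ.re_sum_inner_nonneg b hφ₀ x.2 hx)
    (fun y => by
      obtain ⟨x, hxS, hx⟩ := exists_add_mem_accretiveCone S y
      exact ⟨⟨x, hxS⟩, hx⟩)
  have hgD : ∀ x ∈ D, g x = (f₀ x).re := fun x hx => hgf ⟨x, hx⟩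
  -- Both `z` and `-z` lie in the cone. This makes the complexification of `g` Hermitian.
  have hg0 : ∀ z, (∀ α, pairing α z + star (pairing α z) = 0) → g z = 0 := by
    intro z hz
    refine le_antisymm ?_ (hg z fun α => (hz α).ge)
    have := hg (-z) fun α => by
      have := hz α
      rw [map_neg, star_neg, ← neg_add, this, neg_zero]
    simpa using this
  let G : (ι × ι →₀ A) →ₗ[ℂ] ℂ := Module.Dual.extendRCLike (𝕜 := ℂ) g
  have hG : ∀ x, G x = g x - Complex.I * g (Complex.I • x) :=
    fun x => Module.Dual.extendRCLike_apply (𝕜 := ℂ) g x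
  have hconj : ∀ x y, (∀ α, pairing α y = star (pairing α x)) → G y = starRingEnd ℂ (G x) := by
    intro x y hxy
    have h1 : g (y - x) = 0 := hg0 _ fun α => by simp [hxy]
    have h2 : g (Complex.I • y + Complex.I • x) = 0 := hg0 _ fun α => by
      simp [hxy]
    rw [map_sub, sub_eq_zero] at h1
    rw [map_add, add_eq_zero_iff_eq_neg] at h2
    rw [hG, hG, h1, h2]
    simp
  refine ⟨G, fun i j x => ?_, fun x hx => ?_, hconj⟩
  · have hD : single (i, j) (x : A) ∈ D := fun p => by
      rw [single_apply]
      split_ifs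
      exacts [x.2, S.zero_mem]
    have hval : f₀ (single (i, j) (x : A)) = ⟪b i, φ x (b j)⟫_ℂ := by
      rw [hf₀, Finsupp.sum_single_index (by simp), hφ₀]
    rw [hG, hgD _ hD, hgD _ (D.smul_mem _ hD), map_smul, hval]
    apply Complex.ext <;> simp
  · have hx1 : G x = starRingEnd ℂ (G x) :=
      hconj x x fun α => (hx α).isSelfAdjoint.star_eq.symm
    have hx2 : 0 ≤ g x := hg x fun α => add_nonneg (hx α) (star_nonneg_iff.2 (hx α))
    rw [← RCLike.conj_eq_iff_re.1 hx1.symm]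
    have : (G x).re = g x := by simp [hG]
    change (0 : ℂ) ≤ ((G x).re : ℂ)
    rw [this]
    exact_mod_cast hx2

/-- Every unital completely positive map on an operator system in `A` is the compression of a
representation of `A`. This combines Arveson's extension theorem and Stinespring's theorem. -/
theorem exists_representation_dilation (φ : UCPMap S H) :
    ∃ (K : Type (max u v w)) (_ : NormedAddCommGroup K) (_ : InnerProductSpace ℂ K)
      (_ : CompleteSpace K) (V : H →ₗᵢ[ℂ] K) (π : A →⋆ₐ[ℂ] (K →L[ℂ] K)),
      ∀ x : S.toSubmodule,
        adjoint V.toContinuousLinearMap ∘L π (x : A) ∘L V.toContinuousLinearMap = φ x := by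
  -- The index set is `H` itself; `ULift` only places the completed space in the required universe.
  obtain ⟨G, hGφ, hGpos, hGconj⟩ := φ.exists_positive_functional (ULift.down : ULift.{w} H → H)
  let c : PreInnerProductSpace.Core ℂ (ULift.{w} H →₀ A) :=
    { inner := fun f g => G (starMulMatrix f g)
      conj_inner_symm := fun f g => (hGconj _ _ fun α => by
        simp [pairing_starMulMatrix]).symm
      re_inner_nonneg := fun f => (Complex.le_def.1 (hGpos _ fun α => by
        rw [pairing_starMulMatrix]
        exact star_mul_self_nonneg _)).1
      add_left := fun f g h => by
        rw [← map_add]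
        congr 1
        ext p
        simp [add_mul]
      smul_left := fun f g r => by
        rw [← smul_eq_mul, ← map_smul]
        congr 1
        ext p
        simp }
  have hc : ∀ f g, c.inner f g = G (starMulMatrix f g) := fun _ _ => rfl
  have hbound : ∀ (a : A) (f : ULift.{w} H →₀ A),
      (c.inner (a • f) (a • f)).re ≤ ‖a‖ ^ 2 * (c.inner f f).re := by
    intro a f
    have h := hGpos (((‖a‖ ^ 2 : ℝ) : ℂ) • starMulMatrix f f - starMulMatrix (a • f) (a • f))
      fun α => ?_
    · rw [map_sub, map_smul, smul_eq_mul] at h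
      have h2 := (Complex.le_def.1 h).1
      rw [Complex.sub_re, Complex.re_ofReal_mul, Complex.zero_re, sub_nonneg] at h2
      exact h2
    · have hs : ((a • f).sum fun i d => d * α i) = a * f.sum fun i d => d * α i := by
        rw [Finsupp.sum_smul_index' (by simp), Finsupp.mul_sum]
        simp [mul_assoc]
      rw [map_sub, map_smul, pairing_starMulMatrix, pairing_starMulMatrix, hs, sub_nonneg,
        star_mul, Complex.coe_smul, sq, ← CStarRing.norm_star_mul_self (x := a)]
      convert CStarAlgebra.star_left_conjugate_le_norm_smul (b := star a * a) using 1
      simp only [mul_assoc]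
  have hadj : ∀ (a : A) (f g : ULift.{w} H →₀ A),
      c.inner (star a • f) g = c.inner f (a • g) := by
    intro a f g
    rw [hc, hc]
    congr 1
    ext p
    simp [mul_assoc]
  obtain ⟨K, i1, i2, i3, π, J, hJ, hπ⟩ :=
    c.exists_starAlgHom (Algebra.lsmul (A := A) ℂ ℂ _) hbound hadj
  have hin : ∀ (h k : H) (x : S.toSubmodule),
      ⟪J (single ⟨h⟩ 1), π x (J (single ⟨k⟩ 1))⟫_ℂ = ⟪h, φ x k⟫_ℂ := by
    intro h k x
    rw [hπ, hJ, hc, Algebra.lsmul_coe]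
    beta_reduce
    rw [smul_single, starMulMatrix_single, star_one, one_mul, smul_eq_mul, mul_one, hGφ]
  have hin1 : ∀ h k : H, ⟪J (single ⟨h⟩ 1), J (single ⟨k⟩ 1)⟫_ℂ = ⟪h, k⟫_ℂ := by
    intro h k
    have h1 : φ.toLinearMap ⟨1, S.one_mem⟩ = 1 := φ.map_one
    simpa [h1] using hin h k ⟨1, S.one_mem⟩
  -- The map `h ↦ single ⟨h⟩ 1` is not linear. It becomes so under `J`, because by `hin1` the
  -- defects have norm zero.
  let V : H →ₗᵢ[ℂ] K :=
    { toFun := fun h => J (single ⟨h⟩ 1)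
      map_add' := fun h k => by
        rw [← sub_eq_zero, ← inner_self_eq_zero (𝕜 := ℂ)]
        simp only [inner_sub_left, inner_sub_right, inner_add_left, inner_add_right, hin1]
        ring
      map_smul' := fun r h => by
        rw [← sub_eq_zero, ← inner_self_eq_zero (𝕜 := ℂ)]
        simp only [inner_sub_left, inner_sub_right, inner_smul_left, inner_smul_right, hin1,
          RingHom.id_apply]
        ring
      norm_map' := fun h => by
        have := hin1 h h
        rw [inner_self_eq_norm_sq_to_K, inner_self_eq_norm_sq_to_K] at this
        exact (sq_eq_sq₀ (norm_nonneg _) (norm_nonneg _)).1 (by exact_mod_cast this) }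
  refine ⟨K, i1, i2, i3, V, π, fun x => ?_⟩
  ext k
  refine ext_inner_left ℂ fun h => ?_
  rw [ContinuousLinearMap.comp_apply, ContinuousLinearMap.adjoint_inner_right]
  exact hin h k x

end UCPMap

/-- The whole C⋆-algebra as an operator system. -/
noncomputable def OperatorSystem.top (A : Type*) [CStarAlgebra A] : OperatorSystem A where
  toSubmodule := ⊤
  star_mem _ _ := trivial
  one_mem := trivial
  generates := by
    rw [eq_top_iff]
    exact fun a _ => StarSubalgebra.le_topologicalClosure _
      (StarAlgebra.subset_adjoin ℂ _ (Submodule.mem_top (x := a)))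

/-! ### The two implications -/

namespace UCPMap

variable {A : Type u} [CStarAlgebra A] [PartialOrder A] [StarOrderedRing A]
  {S : OperatorSystem A} {H : Type v} [NormedAddCommGroup H] [InnerProductSpace ℂ H]
  [CompleteSpace H]

lemma IsExtension.map_one {φ : UCPMap S H} {Φ : A →CP (H →L[ℂ] H)} (h : φ.IsExtension Φ) :
    Φ 1 = 1 :=
  (h ⟨1, S.one_mem⟩).trans φ.map_one

/-- **Arveson's extension theorem** for unital completely positive maps. -/
theorem exists_isExtension (φ : UCPMap S H) : ∃ Φ : A →CP (H →L[ℂ] H), φ.IsExtension Φ := by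
  obtain ⟨K, _, _, _, V, π, hπ⟩ := exists_representation_dilation.{u, v, max u v} φ
  exact ⟨π.toCompletelyPositiveMap.compression V.toContinuousLinearMap, hπ⟩

/-- Every completely positive extension of a maximal map is a representation. -/
lemma IsMaximal.exists_starAlgHom_eq {φ : UCPMap S H} (hφ : IsMaximal.{u, v, max u v w} φ)
    {Ψ : A →CP (H →L[ℂ] H)} (hΨ : φ.IsExtension Ψ) :
    ∃ ρ : A →⋆ₐ[ℂ] (H →L[ℂ] H), ∀ a, ρ a = Ψ a := by
  -- Dilating `Ψ` on all of `A`, rather than `φ` on `S`, makes the compression of `π` equal to `Ψ`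
  -- everywhere.
  obtain ⟨K, _, _, _, V, π, hπ⟩ := exists_representation_dilation.{u, v, w}
    (ofCompletelyPositiveMap Ψ hΨ.map_one : UCPMap (OperatorSystem.top A) H)
  replace hπ : ∀ a, adjoint V.toContinuousLinearMap ∘L π a ∘L V.toContinuousLinearMap = Ψ a :=
    fun a => hπ ⟨a, trivial⟩
  let φ' : UCPMap S K := ofCompletelyPositiveMap π.toCompletelyPositiveMap (_root_.map_one π)
  obtain ⟨ψ, hψ⟩ := hφ K V φ' fun x => (hπ x).trans (hΨ x)
  have hcomm := S.commute_of_map_comp_eq π V fun x hx => ⟨φ ⟨x, hx⟩, by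
    ext h
    have := hψ ⟨x, hx⟩ h 0
    rw [map_zero, ZeroMemClass.coe_zero, add_zero, add_zero] at this
    exact this⟩
  obtain ⟨ρ, hρ⟩ := π.exists_compression_eq V hcomm
  exact ⟨ρ, fun a => (hρ a).trans (hπ a)⟩

theorem IsMaximal.hasUniqueExtensionProperty {φ : UCPMap S H}
    (hφ : IsMaximal.{u, v, max u v w} φ) : φ.HasUniqueExtensionProperty := by
  obtain ⟨Φ, hΦ⟩ := φ.exists_isExtension
  obtain ⟨π, hπ⟩ := IsMaximal.exists_starAlgHom_eq.{u, v, w} hφ hΦ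
  refine ⟨Φ, hΦ, fun Ψ hΨ => ?_, π, hπ⟩
  obtain ⟨ρ, hρ⟩ := IsMaximal.exists_starAlgHom_eq.{u, v, w} hφ hΨ
  refine DFunLike.ext _ _ fun a => ?_
  rw [← hπ, ← hρ]
  refine S.starAlgHom_ext (fun x hx => ?_) a
  rw [hπ, hρ]
  exact (hΨ ⟨x, hx⟩).trans (hΦ ⟨x, hx⟩).symm

/-- If the compression of a representation `π` by an isometry `U` is multiplicative, then `U`
intertwines the two. -/
lemma _root_.StarAlgHom.apply_eq_of_compression_eq {A : Type*} [CStarAlgebra A]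
    {H : Type*} [NormedAddCommGroup H] [InnerProductSpace ℂ H] [CompleteSpace H]
    {K : Type*} [NormedAddCommGroup K] [InnerProductSpace ℂ K] [CompleteSpace K]
    (π : A →⋆ₐ[ℂ] (K →L[ℂ] K)) (ρ : A →⋆ₐ[ℂ] (H →L[ℂ] H)) (U : H →ₗᵢ[ℂ] K)
    (h : ∀ a h k, ⟪U h, π a (U k)⟫_ℂ = ⟪h, ρ a k⟫_ℂ) (a : A) (k : H) :
    π a (U k) = U (ρ a k) := by
  have h1 : ⟪π a (U k), π a (U k)⟫_ℂ = ⟪ρ a k, ρ a k⟫_ℂ := by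
    have h2 := h (star a * a) k k
    simpa only [map_mul, StarHomClass.map_star, ContinuousLinearMap.mul_def,
      ContinuousLinearMap.comp_apply, ContinuousLinearMap.star_eq_adjoint,
      ContinuousLinearMap.adjoint_inner_right] using h2
  have h3 : ⟪π a (U k), U (ρ a k)⟫_ℂ = ⟪ρ a k, ρ a k⟫_ℂ := by
    rw [← inner_conj_symm, h, inner_conj_symm]
  -- All four terms in the squared norm of the difference equal `⟪ρ a k, ρ a k⟫`.
  rw [← sub_eq_zero, ← inner_self_eq_zero (𝕜 := ℂ)]
  simp only [inner_sub_left, inner_sub_right, h, h1, h3, U.inner_map_map, sub_self]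

theorem HasUniqueExtensionProperty.isMaximal {φ : UCPMap S H}
    (hφ : φ.HasUniqueExtensionProperty) : IsMaximal.{u, v, w} φ := by
  intro K _ _ _ V φ' hdil
  obtain ⟨Φ, hΦ, huniq, ρ, hρ⟩ := hφ
  obtain ⟨L, _, _, _, W, π, hπ⟩ := exists_representation_dilation.{u, w, w} φ'
  have hφ' : ∀ (x : S.toSubmodule) (h k : K), ⟪W h, π x (W k)⟫_ℂ = ⟪h, φ' x k⟫_ℂ := by
    intro x h k
    rw [← hπ x, ContinuousLinearMap.comp_apply, ContinuousLinearMap.adjoint_inner_right]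
    rfl
  have hV : ∀ (x : S.toSubmodule) (h k : H), ⟪V h, φ' x (V k)⟫_ℂ = ⟪h, φ x k⟫_ℂ := by
    intro x h k
    rw [← hdil x, ContinuousLinearMap.comp_apply, ContinuousLinearMap.adjoint_inner_right]
    rfl
  let U : H →ₗᵢ[ℂ] L := W.comp V
  have hU : π.toCompletelyPositiveMap.compression U.toContinuousLinearMap = Φ := by
    refine huniq _ fun x => ?_
    ext k
    refine ext_inner_left ℂ fun h => ?_
    rw [← hV, ← hφ']
    exact ContinuousLinearMap.adjoint_inner_right U.toContinuousLinearMap h (π x (U k))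
  have hπU : ∀ a h k, ⟪U h, π a (U k)⟫_ℂ = ⟪h, ρ a k⟫_ℂ := by
    intro a h k
    rw [hρ, ← hU]
    exact (ContinuousLinearMap.adjoint_inner_right U.toContinuousLinearMap h (π a (U k))).symm
  have hinv : ∀ (x : S.toSubmodule) (h : H), φ' x (V h) = V (φ x h) := by
    intro x h
    refine ext_inner_left ℂ fun k => ?_
    have := π.apply_eq_of_compression_eq ρ U hπU x h
    rw [hρ, hΦ x] at this
    -- Pairing with `W k` transfers the identity in `L` back to `K`.
    rw [← hφ', ← W.inner_map_map k]
    exact congrArg (inner ℂ (W k)) this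
  let N : Submodule ℂ K := (LinearMap.range V.toLinearMap)ᗮ
  refine ⟨φ'.compression N.subtypeₗᵢ, fun x h k => ?_⟩
  have hk : φ' x k ∈ N := by
    rw [Submodule.mem_orthogonal]
    rintro _ ⟨g, rfl⟩
    have h1 := hinv ⟨star (x : A), S.star_mem x x.2⟩ g
    have h2 : ⟪φ' ⟨star (x : A), S.star_mem x x.2⟩ (V g), (k : K)⟫_ℂ = 0 := by
      rw [h1]
      exact Submodule.inner_right_of_mem_orthogonal (LinearMap.mem_range_self V.toLinearMap _) k.2
    rwa [φ'.map_star, ContinuousLinearMap.star_eq_adjoint,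
      ContinuousLinearMap.adjoint_inner_left] at h2
  have hψ : φ'.compression N.subtypeₗᵢ x k = ⟨φ' x k, hk⟩ := by
    refine ext_inner_left ℂ fun g => ?_
    exact ContinuousLinearMap.adjoint_inner_right N.subtypeₗᵢ.toContinuousLinearMap g (φ' x k)
  rw [map_add, hinv, hψ]

end UCPMap

/-- Maximality is tested in a universe large enough to contain the dilation spaces built from `H →₀
A`. -/
theorem proposition2p3 {A : Type u} [CStarAlgebra A] [PartialOrder A]
    [StarOrderedRing A] (S : OperatorSystem A) {H : Type v} [NormedAddCommGroup H]
    [InnerProductSpace ℂ H] [CompleteSpace H] (φ : UCPMap S H) :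
    φ.HasUniqueExtensionProperty ↔ UCPMap.IsMaximal.{u, v, max u v w} φ :=
  ⟨fun h => h.isMaximal, fun h => UCPMap.IsMaximal.hasUniqueExtensionProperty.{u, v, w} h⟩
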